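/- Let $n\ge k\ge 1$ be integers. An ordered partition of $[n]=\{1,\dots,n\}$ into $k$ blocks is a sequence $\pi=B_1/B_2/\cdots/B_k$ of pairwise disjoint non-empty sets with union $[n]$. For a permutation $\sigma\in S_k$, a $\sigma$-partition is an ordered partition of the form $\pi=B_{\sigma(1)}/B_{\sigma(2)}/\cdots/B_{\sigma(k)}$, where $B_1,\dots,B_k$ are non-empty, pairwise disjoint, have union $[n]$, and satisfy $\min B_1<\min B_2<\cdots<\min B_k$. Let $\mathcal P_n^k(\sigma)$ be the set of all $\sigma$-partitions of $[n]$ into $k$ blocks, and let $\operatorname{inv}\sigma$ be the number of pairs $i<j$ with $\sigma(i)>\sigma(j)$. For an ordered partition $\pi=B_1/\cdots/B_k$ of $[n]$, let $w_i$ be the index $j$ with $i\in B_j$, let $\operatorname{open}\pi=\{\min B_1,\dots,\min B_k\}$ and $\operatorname{clos}\pi=\{\max B_1,\dots,\max B_k\}$, and put \begin{align*} \operatorname{ros}\pi&=\sum_{i=1}^n\#\{j\in\operatorname{open}\pi: j<i,\ w_j>w_i\}, & \operatorname{lob}\pi&=\sum_{i=1}^n\#\{j\in\operatorname{open}\pi: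 j>i,\ w_j<w_i\},\\ \operatorname{lcs}\pi&=\sum_{i=1}^n\#\{j\in\operatorname{clos}\pi: j<i,\ w_j<w_i\}, & \operatorname{rcb}\pi&=\sum_{i=1}^n\#\{j\in\operatorname{clos}\pi: j>i,\ w_j>w_i\},\\ \operatorname{lsb}\pi&=\sum_{i=1}^n\#\{b<w_i: \min B_b<i<\max B_b\}, & \operatorname{bInv}\pi&=\#\{(a,b): a<b,\ \min B_a>\max B_b\}. \end{align*} Let $\mathrm{MAK}=\operatorname{ros}+\operatorname{lcs}$, $\mathrm{MAK}'=\operatorname{lob}+\operatorname{rcb}$ and $\operatorname{cinvLSB}=\operatorname{lsb}+\left(\binom k2-\operatorname{bInv}\right)+\binom k2$. Let $[k]_{p,q}=\sum_{i=0}^{k-1}p^{k-1-i}q^i$, and let the $p,q$-Stirling numbers $S_{p,q}(n,k)$ be defined by $S_{p,q}(0,0)=1$, $S_{p,q}(n,k)=p^{k-1}S_{p,q}(n-1,k-1)+[k]_{p,q}S_{p,q}(n-1,k)$ for $0<k\le n$, and $S_{p,q}(n,k)=0$ otherwise. Theorem. For every $\sigma\in S_k$, the triples of statistics $$(\mathrm{MAK}+\operatorname{bInv},\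 \mathrm{MAK}'+\operatorname{bInv},\ \operatorname{cinvLSB})\quad\text{and}\quad(\mathrm{MAK}'+\operatorname{bInv},\ \mathrm{MAK}+\operatorname{bInv},\ \operatorname{cinvLSB})$$ are equidistributed on $\mathcal P_n^k(\sigma)$, i.e. each triple of values is attained by the same number of $\pi\in\mathcal P_n^k(\sigma)$ under both. Moreover, for each $\mathrm{maf}\in\{\mathrm{MAK},\mathrm{MAK}'\}$, $$\sum_{\pi\in\mathcal P_n^k(\sigma)}p^{(\mathrm{maf}+\operatorname{bInv})\pi}\,q^{\operatorname{cinvLSB}\pi}=q^{k(k-1)}\left(\frac pq\right)^{\operatorname{inv}\sigma}S_{p,q}(n,k),$$ for all elements $p$ and $q\neq0$ of any field (in particular, for $p$ and $q$ indeterminates). -/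

import Mathlib

/-- An ordered partition of `[n]` into `k` (non-empty) blocks `B_1/B_2/⋯/B_k`, given by the map `w`
sending each letter to the index of the block containing it; all blocks are non-empty exactly when
`w` is surjective. Letters and block indices are counted from `0`, so that `[n]` is `Fin n`. -/
abbrev OrderedPartition (n k : ℕ) : Type :=
  {w : Fin n → Fin k // Function.Surjective w}

namespace OrderedPartition

variable {n k : ℕ}

/-- `π.idx i` is the index `w_i` of the block containing the letter `i`. -/
def idx (π : OrderedPartition n k) (i : Fin n) : Fin k := π.1 i

/-- `π.block b` is the block `B_b`, the `b`-th block from the left. -/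
def block (π : OrderedPartition n k) (b : Fin k) : Finset (Fin n) :=
  Finset.univ.filter fun i => π.idx i = b

theorem block_nonempty (π : OrderedPartition n k) (b : Fin k) : (π.block b).Nonempty := by
  obtain ⟨i, hi⟩ := π.2 b
  exact ⟨i, Finset.mem_filter.mpr ⟨Finset.mem_univ i, hi⟩⟩

/-- The opener (least element) of the block `B_b`. -/
def opener (π : OrderedPartition n k) (b : Fin k) : Fin n :=
  (π.block b).min' (π.block_nonempty b)

/-- The closer (greatest element) of the block `B_b`. -/
def closer (π : OrderedPartition n k) (b : Fin k) : Fin n :=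
  (π.block b).max' (π.block_nonempty b)

/-- The set `open(π)` of openers of the blocks of `π`. -/
def openers (π : OrderedPartition n k) : Finset (Fin n) := Finset.univ.image π.opener

/-- The set `clos(π)` of closers of the blocks of `π`. -/
def closers (π : OrderedPartition n k) : Finset (Fin n) := Finset.univ.image π.closer

/-- `π` is an (unordered) partition written in the standard way: its blocks are listed in
increasing order of their openers. -/
def IsStandard (π : OrderedPartition n k) : Prop := StrictMono π.opener

/-- `π` is a `σ`-partition: `π = B_{σ(1)}/B_{σ(2)}/⋯/B_{σ(k)}` where `B_1/B_2/⋯/B_k` is a partition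
with its blocks listed in increasing order of their openers. -/
def IsSigmaPartition (σ : Equiv.Perm (Fin k)) (π : OrderedPartition n k) : Prop :=
  ∃ π₀ : OrderedPartition n k, π₀.IsStandard ∧ ∀ b : Fin k, π.block b = π₀.block (σ b)

instance : DecidablePred (IsStandard (n := n) (k := k)) := fun π =>
  inferInstanceAs (Decidable (∀ a b : Fin k, a < b → π.opener a < π.opener b))

instance (σ : Equiv.Perm (Fin k)) : DecidablePred (IsSigmaPartition (n := n) σ) := fun π =>
  inferInstanceAs (Decidable (∃ π₀ : OrderedPartition n k,
    π₀.IsStandard ∧ ∀ b : Fin k, π.block b = π₀.block (σ b)))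

/-- The coordinate statistic `ros_i` ("right, opener, smaller"). -/
def rosAt (π : OrderedPartition n k) (i : Fin n) : ℕ :=
  (π.openers.filter fun j => j < i ∧ π.idx i < π.idx j).card

/-- The coordinate statistic `lob_i` ("left, opener, bigger"). -/
def lobAt (π : OrderedPartition n k) (i : Fin n) : ℕ :=
  (π.openers.filter fun j => i < j ∧ π.idx j < π.idx i).card

/-- The coordinate statistic `lcs_i` ("left, closer, smaller"). -/
def lcsAt (π : OrderedPartition n k) (i : Fin n) : ℕ :=
  (π.closers.filter fun j => j < i ∧ π.idx j < π.idx i).card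

/-- The coordinate statistic `rcb_i` ("right, closer, bigger"). -/
def rcbAt (π : OrderedPartition n k) (i : Fin n) : ℕ :=
  (π.closers.filter fun j => i < j ∧ π.idx i < π.idx j).card

/-- The coordinate statistic `lsb_i`: the number of blocks to the left of the block containing `i`
whose opener is smaller than `i` and whose closer is greater than `i`. -/
def lsbAt (π : OrderedPartition n k) (i : Fin n) : ℕ :=
  (Finset.univ.filter fun b : Fin k => b < π.idx i ∧ π.opener b < i ∧ i < π.closer b).card

def ros (π : OrderedPartition n k) : ℕ := ∑ i, π.rosAt i

def lob (π : OrderedPartition n k) : ℕ := ∑ i, π.lobAt i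

def lcs (π : OrderedPartition n k) : ℕ := ∑ i, π.lcsAt i

def rcb (π : OrderedPartition n k) : ℕ := ∑ i, π.rcbAt i

def lsb (π : OrderedPartition n k) : ℕ := ∑ i, π.lsbAt i

/-- `MAK = ros + lcs`. -/
def mak (π : OrderedPartition n k) : ℕ := π.ros + π.lcs

/-- `MAK' = lob + rcb`. -/
def mak' (π : OrderedPartition n k) : ℕ := π.lob + π.rcb

/-- The number of block inversions: pairs of indices `a < b` such that all letters of `B_a` are
greater than those of `B_b`. -/
def bInv (π : OrderedPartition n k) : ℕ :=
  (Finset.univ.filter fun ab : Fin k × Fin k =>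
    ab.1 < ab.2 ∧ π.closer ab.2 < π.opener ab.1).card

/-- `cbInv = binom(k,2) - bInv`; the subtraction never truncates, see `bInv_le_choose`. -/
def cbInv (π : OrderedPartition n k) : ℕ := k.choose 2 - π.bInv

/-- `cinvLSB = lsb + cbInv + binom(k,2)`. -/
def cinvLSB (π : OrderedPartition n k) : ℕ := π.lsb + π.cbInv + k.choose 2

theorem bInv_le_choose (π : OrderedPartition n k) : π.bInv ≤ k.choose 2 := by
  have h : π.bInv ≤ ((Finset.univ : Finset (Fin k)).powersetCard 2).card := by
    refine Finset.card_le_card_of_injOn (fun ab => {ab.1, ab.2}) ?_ ?_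
    · rintro ⟨a, b⟩ hab
      have hlt : a < b := by simp at hab; exact hab.1
      simp [Finset.mem_powersetCard, Finset.card_pair hlt.ne]
    · rintro ⟨a, b⟩ hab ⟨c, d⟩ hcd h
      have h1 : a < b := by simp at hab; exact hab.1
      have h2 : c < d := by simp at hcd; exact hcd.1
      have h' : ({a, b} : Finset (Fin k)) = {c, d} := h
      have ha : a ∈ ({c, d} : Finset (Fin k)) := by rw [← h']; simp
      have hb : b ∈ ({c, d} : Finset (Fin k)) := by rw [← h']; simp
      simp only [Finset.mem_insert, Finset.mem_singleton] at ha hb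
      grind
  simpa using h

end OrderedPartition

/-- The set `P_n^k(σ)` of all `σ`-partitions of `[n]` into `k` blocks. -/
def sigmaPartitions (n k : ℕ) (σ : Equiv.Perm (Fin k)) : Finset (OrderedPartition n k) :=
  Finset.univ.filter fun π => π.IsSigmaPartition σ

/-- The number of inversions of a permutation. -/
def permInv {k : ℕ} (σ : Equiv.Perm (Fin k)) : ℕ :=
  (Finset.univ.filter fun ab : Fin k × Fin k => ab.1 < ab.2 ∧ σ ab.2 < σ ab.1).card

/-- `[k]_{p,q} = p^{k-1} + p^{k-2} q + ⋯ + p q^{k-2} + q^{k-1}`. -/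
def pqNumber {K : Type*} [CommSemiring K] (p q : K) (k : ℕ) : K :=
  ∑ i ∈ Finset.range k, p ^ (k - 1 - i) * q ^ i

/-- The `p,q`-Stirling numbers of the second kind `S_{p,q}(n,k)`, given by their recursion
(with these initial values the recursion yields `0` whenever `k > n`). -/
def pqStirling {K : Type*} [CommSemiring K] (p q : K) : ℕ → ℕ → K
  | 0, 0 => 1
  | 0, _ + 1 => 0
  | _ + 1, 0 => 0
  | n + 1, k + 1 => p ^ k * pqStirling p q n k + pqNumber p q (k + 1) * pqStirling p q n (k + 1)

/-! Fix the set `O` of openers and the set `C` of closers, and let the height at `i` be the number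
of blocks open just before `i`. On a `σ`-partition the three statistics split into a part determined
by `O`, `C` and `σ`, plus sums over the non-openers: `rsbAt` for both `MAK + bInv` and `MAK' +
bInv`, and `lsbAt` for `cinvLSB` (`mak_add_bInv`, `mak'_add_bInv`, `cinvLSB_add_permInv`). The parts
that depend on `O` and `C` are the total number of earlier closers for `MAK`, the total number of
later openers for `MAK'`, and the sum of the heights at openers for `cinvLSB`.

Since `σ` fixes the order of the openers, a `σ`-partition with data `(O, C)` amounts to choosing,
for each non-opener, one of the `h` open blocks. Weighted by `rsbAt` and `lsbAt`, each choice
contributes `[h]_{p,q}` whatever the earlier choices were (`sum_blockWords`). So the joint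
generating function is a sum over weighted paths (`sum_sigmaPartitions`).

Reading paths backwards exchanges openers with closers, hence earlier closers with later openers. It
preserves the weight because rises and falls match level by level (`pathWeight_reflectSet`). This
gives the equidistribution. Forgetting one of the two statistics leaves `pathSum p q n k k`, which
`pathSum_eq` evaluates through a closed formula for paths that need not return to height zero. -/

/-! ### `p,q`-numbers, `p,q`-binomials and reduced Stirling numbers. -/

section PqNumbers

variable {K : Type*} [CommSemiring K] (p q : K)

theorem pqNumber_zero : pqNumber p q 0 = 0 := by simp [pqNumber]

theorem pqNumber_one : pqNumber p q 1 = 1 := by simp [pqNumber]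

theorem pqNumber_succ (a : ℕ) : pqNumber p q (a + 1) = p * pqNumber p q a + q ^ a := by
  unfold pqNumber
  rw [Finset.sum_range_succ, Finset.mul_sum]
  congr 1
  · refine Finset.sum_congr rfl fun i hi => ?_
    have hi := Finset.mem_range.mp hi
    rw [show a + 1 - 1 - i = (a - 1 - i) + 1 by omega, pow_succ']
    ring
  · simp

theorem pqNumber_add (a b : ℕ) :
    pqNumber p q (a + b) = p ^ a * pqNumber p q b + q ^ b * pqNumber p q a := by
  induction a with
  | zero => simp [pqNumber_zero]
  | succ a ih =>
    rw [show a + 1 + b = a + b + 1 by ring, pqNumber_succ, ih, pqNumber_succ]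
    ring

/-- Choosing an element `b` of a finite chain `S` with weight
`p ^ #{elements above b} * q ^ #{elements below b}` amounts to `[#S]_{p,q}`. -/
theorem sum_pow_card_above_mul_pow_card_below {α : Type*} [LinearOrder α] (S : Finset α) :
    ∑ b ∈ S, p ^ (S.filter fun c => b < c).card * q ^ (S.filter fun c => c < b).card =
      pqNumber p q S.card := by
  induction S using Finset.induction_on_max with
  | empty => simp [pqNumber_zero]
  | insert a S ha ih =>
    have haS : a ∉ S := fun h => lt_irrefl _ (ha a h)
    rw [Finset.sum_insert haS, Finset.card_insert_of_notMem haS, pqNumber_succ, ← ih,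
      Finset.mul_sum, add_comm]
    congr 1
    · refine Finset.sum_congr rfl fun b hb => ?_
      have hba := ha b hb
      rw [Finset.filter_insert, if_pos hba, Finset.filter_insert, if_neg hba.not_gt,
        Finset.card_insert_of_notMem (by simp [haS]), pow_succ']
      ring
    · rw [Finset.filter_insert, if_neg (lt_irrefl _), Finset.filter_insert, if_neg (lt_irrefl _),
        Finset.filter_false_of_mem (fun c hc => (ha c hc).not_gt),
        Finset.filter_true_of_mem ha]
      simp

/-- The `p,q`-binomial coefficients, given by their Pascal recursion. -/
def pqBinom : ℕ → ℕ → K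
  | _, 0 => 1
  | 0, _ + 1 => 0
  | j + 1, c + 1 => p ^ (c + 1) * pqBinom j (c + 1) + q ^ (j - c) * pqBinom j c

@[simp] theorem pqBinom_zero_right (j : ℕ) : pqBinom p q j 0 = 1 := by cases j <;> rfl

theorem pqBinom_succ_succ (j c : ℕ) : pqBinom p q (j + 1) (c + 1) =
    p ^ (c + 1) * pqBinom p q j (c + 1) + q ^ (j - c) * pqBinom p q j c := rfl

theorem pqBinom_eq_zero {j c : ℕ} (h : j < c) : pqBinom p q j c = 0 := by
  induction j generalizing c with
  | zero => obtain ⟨c, rfl⟩ := Nat.exists_eq_add_of_lt h; simp [pqBinom]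
  | succ j ih =>
    obtain ⟨c, rfl⟩ : ∃ d, c = d + 1 := ⟨c - 1, by omega⟩
    rw [pqBinom_succ_succ, ih (by omega), ih (by omega)]
    simp

@[simp] theorem pqBinom_self (j : ℕ) : pqBinom p q j j = 1 := by
  induction j with
  | zero => simp
  | succ j ih => rw [pqBinom_succ_succ, pqBinom_eq_zero p q j.lt_succ_self, ih]; simp

/-- The absorption identity for `p,q`-binomials; it lets the closing term of the path recursion be
merged with the non-closing one in `pathSum_eq`. In the induction both sides become a common
binomial times one `p,q`-number, split by `pqNumber_add` in two ways. -/
theorem pqBinom_mul_pqNumber (j c : ℕ) :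
    pqBinom p q j c * pqNumber p q (j - c) =
      pqBinom p q j (c + 1) * pqNumber p q (c + 1) := by
  induction j generalizing c with
  | zero => simp [pqBinom, pqNumber_zero]
  | succ j ih =>
    cases c with
    | zero =>
      have h := ih 0
      rw [pqBinom_succ_succ]
      simp only [pqBinom_zero_right, Nat.sub_zero, zero_add, pqNumber_one, one_mul,
        mul_one, pow_one] at h ⊢
      rw [pqNumber_succ, h]
    | succ c =>
      rcases Nat.lt_or_ge c j with hcj | hcj
      · have h1 := ih c
        have h2 := ih (c + 1)
        obtain ⟨l, rfl⟩ := Nat.exists_eq_add_of_lt hcj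
        simp only [show c + l + 1 + 1 - (c + 1) = l + 1 by omega,
          show c + l + 1 - c = l + 1 by omega, show c + l + 1 - (c + 1) = l by omega]
          at h1 h2 ⊢
        rw [pqBinom_succ_succ p q (c + l + 1) c, pqBinom_succ_succ p q (c + l + 1) (c + 1),
          show c + l + 1 - c = l + 1 by omega, show c + l + 1 - (c + 1) = l by omega]
        calc _ = pqBinom p q (c + l + 1) (c + 1) *
              (p ^ (c + 1) * pqNumber p q (l + 1) + q ^ (l + 1) * pqNumber p q (c + 1)) := by
              rw [add_mul, mul_assoc (q ^ _), h1]; ring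
          _ = pqBinom p q (c + l + 1) (c + 1) *
              (p ^ (c + 2) * pqNumber p q l + q ^ l * pqNumber p q (c + 2)) := by
              rw [← pqNumber_add, ← pqNumber_add, show c + 1 + (l + 1) = c + 2 + l by ring]
          _ = _ := by
              rw [add_mul, mul_assoc (p ^ _), ← h2]; ring
      · rw [show j + 1 - (c + 1) = 0 by omega, pqBinom_eq_zero p q (show j + 1 < c + 1 + 1 by omega),
          pqNumber_zero]
        simp

/-- The `p,q`-Stirling numbers divided by `p ^ (k.choose 2)`. -/
def pqStirlingReduced : ℕ → ℕ → K
  | 0, 0 => 1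
  | 0, _ + 1 => 0
  | _ + 1, 0 => 0
  | n + 1, k + 1 =>
    pqStirlingReduced n k + pqNumber p q (k + 1) * pqStirlingReduced n (k + 1)

theorem pqStirling_eq_pow_mul_reduced (n k : ℕ) :
    pqStirling p q n k = p ^ k.choose 2 * pqStirlingReduced p q n k := by
  induction n generalizing k with
  | zero => cases k <;> simp [pqStirling, pqStirlingReduced]
  | succ n ih =>
    cases k with
    | zero => simp [pqStirling, pqStirlingReduced]
    | succ k =>
      rw [pqStirling, pqStirlingReduced, ih, ih, Nat.choose_succ_succ' k 1, Nat.choose_one_right,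
        pow_add]
      ring

end PqNumbers

/-! ### Weighted paths and their evaluation by `p,q`-Stirling numbers. -/

section Paths

/-- The number of elements of `S` below `i`. -/
def countBelow (S : Finset ℕ) (i : ℕ) : ℕ := (S.filter (· < i)).card

/-- The number of elements of `S` above `i`. -/
def countAbove (S : Finset ℕ) (i : ℕ) : ℕ := (S.filter (i < ·)).card

/-- The number of open blocks just before the letter `i`, when the openers are the elements of `O`
and the closers are the elements of `C`. -/
def pathHeight (O C : Finset ℕ) (i : ℕ) : ℕ := countBelow O i - countBelow C i

theorem countBelow_succ (S : Finset ℕ) (i : ℕ) :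
    countBelow S (i + 1) = countBelow S i + if i ∈ S then 1 else 0 := by
  unfold countBelow
  have h : S.filter (· < i + 1) = S.filter (· < i) ∪ S.filter (· = i) := by
    ext x; simp only [Finset.mem_filter, Finset.mem_union]; grind
  rw [h, Finset.card_union_of_disjoint, Finset.filter_eq']
  · split_ifs <;> simp
  · rw [Finset.disjoint_filter]; intro x _ h1 h2; omega

theorem countBelow_eq_card {S : Finset ℕ} {n : ℕ} (h : S ⊆ Finset.range n) :
    countBelow S n = S.card := by
  unfold countBelow
  rw [Finset.filter_true_of_mem fun x hx => Finset.mem_range.mp (h hx)]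

theorem countBelow_insert {S : Finset ℕ} {m i : ℕ} (h : i ≤ m) :
    countBelow (insert m S) i = countBelow S i := by
  unfold countBelow
  rw [Finset.filter_insert, if_neg (by omega)]

theorem countBelow_add_countAbove (S : Finset ℕ) (i : ℕ) :
    countBelow S (i + 1) + countAbove S i = S.card := by
  unfold countBelow countAbove
  rw [← Finset.card_filter_add_card_filter_not (s := S) (· < i + 1)]
  congr 2
  ext x; simp

variable {K : Type*} [CommSemiring K] (p q : K)

/-- The weight of the family of all partitions of `{0, …, n - 1}` with set of openers `O` and set
of closers `C`. -/
def pathWeight (n : ℕ) (O C : Finset ℕ) : K :=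
  ∏ i ∈ Finset.range n,
    if i ∈ O then q ^ pathHeight O C i else pqNumber p q (pathHeight O C i)

/-- The generating function of the paths of length `n` with `j` openers and `c` closers. -/
def pathSum (n j c : ℕ) : K :=
  ∑ O ∈ (Finset.range n).powersetCard j, ∑ C ∈ (Finset.range n).powersetCard c,
    p ^ (∑ i ∈ Finset.range n, countBelow C i) * pathWeight p q n O C

theorem sum_powersetCard_succ_range {M : Type*} [AddCommMonoid M] (m j : ℕ) (f : Finset ℕ → M) :
    ∑ S ∈ (Finset.range (m + 1)).powersetCard (j + 1), f S =
      ∑ S ∈ (Finset.range m).powersetCard (j + 1), f S +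
        ∑ S ∈ (Finset.range m).powersetCard j, f (insert m S) := by
  have hm : ∀ {i : ℕ} {S}, S ∈ (Finset.range m).powersetCard i → m ∉ S := fun hS h =>
    Finset.notMem_range_self ((Finset.mem_powersetCard.mp hS).1 h)
  rw [Finset.range_add_one, Finset.powersetCard_succ_insert Finset.notMem_range_self,
    Finset.sum_union, Finset.sum_image]
  · intro S hS T hT h
    rw [← Finset.erase_insert (hm hS), ← Finset.erase_insert (hm hT)]
    exact congrArg (Finset.erase · m) h
  · rw [Finset.disjoint_left]
    intro S hS hS'
    obtain ⟨T, -, rfl⟩ := Finset.mem_image.mp hS'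
    exact hm hS (Finset.mem_insert_self _ _)

theorem pathHeight_congr {O O' C C' : Finset ℕ} {i : ℕ} (hO : countBelow O i = countBelow O' i)
    (hC : countBelow C i = countBelow C' i) : pathHeight O C i = pathHeight O' C' i := by
  unfold pathHeight; rw [hO, hC]

/-- The summand of `pathSum`. -/
def pathTerm (n : ℕ) (O C : Finset ℕ) : K :=
  p ^ (∑ i ∈ Finset.range n, countBelow C i) * pathWeight p q n O C

/-- The factor contributed to `pathTerm` by the letter `n`, when it is preceded by `j` openers and
`c` closers; `b` tells whether it is an opener. -/
def pathStep (b : Bool) (j c : ℕ) : K :=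
  p ^ c * if b then q ^ (j - c) else pqNumber p q (j - c)

/-- Counts below `i ≤ m` do not see `m`, so earlier factors are unchanged and the new factor depends
on `O` and `C` only through their sizes. This is what makes `pathSum` satisfy a recursion. -/
theorem pathTerm_succ {m : ℕ} {O C O' C' : Finset ℕ} (hO : O ⊆ Finset.range m)
    (hC : C ⊆ Finset.range m) (hO' : O' = O ∨ O' = insert m O) (hC' : C' = C ∨ C' = insert m C) :
    pathTerm p q (m + 1) O' C' =
      pathStep p q (decide (m ∈ O')) O.card C.card * pathTerm p q m O C := by
  have hb : ∀ {S S' : Finset ℕ}, S' = S ∨ S' = insert m S → ∀ i ≤ m,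
      countBelow S' i = countBelow S i := by
    rintro S S' (rfl | rfl) i hi
    · rfl
    · exact countBelow_insert hi
  have hh : ∀ i ≤ m, pathHeight O' C' i = pathHeight O C i := fun i hi =>
    pathHeight_congr (hb hO' i hi) (hb hC' i hi)
  have hmem : ∀ i < m, (i ∈ O' ↔ i ∈ O) := by
    rcases hO' with rfl | rfl <;> intro i hi
    · rfl
    · simp [hi.ne]
  unfold pathTerm pathWeight pathStep
  rw [Finset.sum_range_succ, Finset.prod_range_succ, hh m le_rfl, hb hC' m le_rfl,
    countBelow_eq_card hC, pathHeight, countBelow_eq_card hC, countBelow_eq_card hO,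
    Finset.sum_congr rfl fun i hi => hb hC' i (Finset.mem_range.mp hi).le,
    Finset.prod_congr rfl fun i hi => by
      rw [hh i (Finset.mem_range.mp hi).le, if_congr (hmem i (Finset.mem_range.mp hi)) rfl rfl]]
  simp only [decide_eq_true_eq]
  ring

/-- Used with `f` and `g` each the identity or `insert m`, one combination for each way the letter
`m` can be an opener or not and a closer or not. -/
theorem sum_sum_pathTerm {m j c : ℕ} (f g : Finset ℕ → Finset ℕ) (b : Bool)
    (hf : ∀ O ⊆ Finset.range m, (f O = O ∨ f O = insert m O) ∧ decide (m ∈ f O) = b)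
    (hg : ∀ C, g C = C ∨ g C = insert m C) :
    ∑ O ∈ (Finset.range m).powersetCard j, ∑ C ∈ (Finset.range m).powersetCard c,
      pathTerm p q (m + 1) (f O) (g C) = pathStep p q b j c * pathSum p q m j c := by
  rw [pathSum, Finset.mul_sum]
  refine Finset.sum_congr rfl fun O hO => ?_
  rw [Finset.mul_sum]
  refine Finset.sum_congr rfl fun C hC => ?_
  rw [Finset.mem_powersetCard] at hO hC
  rw [pathTerm_succ p q hO.1 hC.1 (hf O hO.1).1 (hg C), (hf O hO.1).2, hO.2, hC.2]
  rfl

theorem pathSum_eq_sum_pathTerm (n j c : ℕ) : pathSum p q n j c =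
    ∑ O ∈ (Finset.range n).powersetCard j, ∑ C ∈ (Finset.range n).powersetCard c,
      pathTerm p q n O C := rfl

theorem pathSum_succ_zero_zero (m : ℕ) :
    pathSum p q (m + 1) 0 0 = pathStep p q false 0 0 * pathSum p q m 0 0 := by
  rw [← sum_sum_pathTerm p q (fun O => O) (fun C => C) false
    (fun O hO => ⟨.inl rfl, by simpa using fun h => Finset.notMem_range_self (hO h)⟩)
    (fun C => .inl rfl), pathSum_eq_sum_pathTerm]
  simp

theorem pathSum_succ_zero_succ (m c : ℕ) :
    pathSum p q (m + 1) 0 (c + 1) = pathStep p q false 0 (c + 1) * pathSum p q m 0 (c + 1) +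
      pathStep p q false 0 c * pathSum p q m 0 c := by
  have hn : ∀ O ⊆ Finset.range m, (O = O ∨ O = insert m O) ∧ decide (m ∈ O) = false :=
    fun O hO => ⟨.inl rfl, by simpa using fun h => Finset.notMem_range_self (hO h)⟩
  rw [← sum_sum_pathTerm p q (fun O => O) (fun C => C) false hn (fun C => .inl rfl),
    ← sum_sum_pathTerm p q (fun O => O) (fun C => insert m C) false hn (fun C => .inr rfl),
    pathSum_eq_sum_pathTerm]
  simp [sum_powersetCard_succ_range]

theorem pathSum_succ_succ_zero (m j : ℕ) :
    pathSum p q (m + 1) (j + 1) 0 = pathStep p q false (j + 1) 0 * pathSum p q m (j + 1) 0 +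
      pathStep p q true j 0 * pathSum p q m j 0 := by
  have hn : ∀ O ⊆ Finset.range m, (O = O ∨ O = insert m O) ∧ decide (m ∈ O) = false :=
    fun O hO => ⟨.inl rfl, by simpa using fun h => Finset.notMem_range_self (hO h)⟩
  have hi : ∀ O ⊆ Finset.range m, (insert m O = O ∨ insert m O = insert m O) ∧
      decide (m ∈ insert m O) = true := fun O hO => ⟨.inr rfl, by simp⟩
  rw [← sum_sum_pathTerm p q (fun O => O) (fun C => C) false hn (fun C => .inl rfl),
    ← sum_sum_pathTerm p q (fun O => insert m O) (fun C => C) true hi (fun C => .inl rfl),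
    pathSum_eq_sum_pathTerm, sum_powersetCard_succ_range]
  simp

theorem pathSum_succ_succ_succ (m j c : ℕ) :
    pathSum p q (m + 1) (j + 1) (c + 1) =
      pathStep p q false (j + 1) (c + 1) * pathSum p q m (j + 1) (c + 1) +
      pathStep p q false (j + 1) c * pathSum p q m (j + 1) c +
      (pathStep p q true j (c + 1) * pathSum p q m j (c + 1) +
      pathStep p q true j c * pathSum p q m j c) := by
  have hn : ∀ O ⊆ Finset.range m, (O = O ∨ O = insert m O) ∧ decide (m ∈ O) = false :=
    fun O hO => ⟨.inl rfl, by simpa using fun h => Finset.notMem_range_self (hO h)⟩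
  have hi : ∀ O ⊆ Finset.range m, (insert m O = O ∨ insert m O = insert m O) ∧
      decide (m ∈ insert m O) = true := fun O hO => ⟨.inr rfl, by simp⟩
  rw [← sum_sum_pathTerm p q (fun O => O) (fun C => C) false hn (fun C => .inl rfl),
    ← sum_sum_pathTerm p q (fun O => insert m O) (fun C => C) true hi (fun C => .inl rfl),
    ← sum_sum_pathTerm p q (fun O => O) (fun C => insert m C) false hn (fun C => .inr rfl),
    ← sum_sum_pathTerm p q (fun O => insert m O) (fun C => insert m C) true hi (fun C => .inr rfl),
    pathSum_eq_sum_pathTerm, sum_powersetCard_succ_range]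
  simp only [sum_powersetCard_succ_range _ c, Finset.sum_add_distrib]

/-- Allowing `j ≠ c` is what lets the induction on the length run. The terms where the last letter
is an opener combine by the Pascal rule; the others combine to `[j]_{p,q}` by absorption and
`pqNumber_add`. -/
theorem pathSum_eq (m j c : ℕ) : pathSum p q m j c =
    pqStirlingReduced p q m j * (q ^ (j - c).choose 2 * p ^ c.choose 2 * pqBinom p q j c) := by
  induction m generalizing j c with
  | zero =>
    cases j <;> cases c <;> simp [pathSum, pathWeight, pqStirlingReduced, pqBinom]
  | succ m ih =>
    cases j with
    | zero =>
      cases c with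
      | zero => simp [pathSum_succ_zero_zero, pathStep, pqNumber_zero, pqStirlingReduced]
      | succ c => simp [pathSum_succ_zero_succ, pathStep, pqNumber_zero, pqStirlingReduced]
    | succ j =>
      cases c with
      | zero =>
        rw [pathSum_succ_succ_zero, ih, ih]
        simp only [pathStep, pqStirlingReduced, pow_zero, Nat.sub_zero, pqBinom_zero_right,
          Nat.choose_zero_succ, Nat.choose_succ_succ' j 1, Nat.choose_one_right, pow_add, if_true,
          Bool.false_eq_true, if_false]
        ring
      | succ c =>
        rw [pathSum_succ_succ_succ, ih, ih, ih, ih]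
        simp only [pathStep, pqStirlingReduced, if_true, Bool.false_eq_true, if_false,
          Nat.add_sub_add_right]
        rcases lt_trichotomy j c with h | rfl | h
        -- If `j + 1 = c`, the binomial in the closing term is `1`; there the factor `[0]_{p,q}`
        -- makes the term vanish.
        · rw [pqBinom_eq_zero p q (show j < c by omega),
            pqBinom_eq_zero p q (show j + 1 < c + 1 by omega),
            pqBinom_eq_zero p q (show j < c + 1 by omega),
            show j + 1 - c = 0 by omega, pqNumber_zero]
          simp
        · have h := pqBinom_mul_pqNumber p q (j + 1) j
          rw [show j + 1 - j = 1 by omega, pqNumber_one, pqBinom_self] at h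
          rw [pqBinom_eq_zero p q j.lt_succ_self, show j + 1 - j = 1 by omega]
          simp only [pqBinom_self, Nat.sub_self, pqNumber_zero, pqNumber_one, mul_one, one_mul] at h ⊢
          rw [h, Nat.choose_succ_succ' j 1, Nat.choose_one_right, pow_add]
          simp
          ring
        · obtain ⟨l, rfl⟩ := Nat.exists_eq_add_of_lt h
          have h1 := pqBinom_mul_pqNumber p q (c + l + 1 + 1) c
          have h2 := pqBinom_succ_succ p q (c + l + 1) c
          have h3 := pqNumber_add p q (c + 1) (l + 1)
          simp only [show c + l + 1 + 1 - c = l + 2 by omega,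
            show c + l + 1 - c = l + 1 by omega, show c + l + 1 - (c + 1) = l by omega] at h1 h2 ⊢
          have e1 : (l + 2).choose 2 = (l + 1).choose 2 + (l + 1) := by
            rw [Nat.choose_succ_succ' (l + 1) 1, Nat.choose_one_right, add_comm]
          have e2 : (l + 1).choose 2 = l.choose 2 + l := by
            rw [Nat.choose_succ_succ' l 1, Nat.choose_one_right, add_comm]
          have e3 : (c + 1).choose 2 = c.choose 2 + c := by
            rw [Nat.choose_succ_succ' c 1, Nat.choose_one_right, add_comm]
          -- The summand `p ^ (c + 1) * [l + 1]` comes from a last letter that is neither opener nor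
          -- closer, the summand `q ^ (l + 1) * [c + 1]` from a closing one (`hA`); `hB` is the
          -- Pascal rule for the two opening cases.
          rw [show c + l + 1 + 1 = c + 1 + (l + 1) by ring, h3,
            show c + 1 + (l + 1) = c + l + 1 + 1 by ring, e1]
          generalize pqStirlingReduced p q m (c + l + 1 + 1) = s1
          generalize pqStirlingReduced p q m (c + l + 1) = s0
          have hA : p ^ c * pqNumber p q (l + 2) * (s1 * (q ^ ((l + 1).choose 2 + (l + 1)) *
              p ^ c.choose 2 * pqBinom p q (c + l + 1 + 1) c)) =
              s1 * q ^ ((l + 1).choose 2) * q ^ (l + 1) * p ^ c.choose 2 * p ^ c *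
              (pqBinom p q (c + l + 1 + 1) (c + 1) * pqNumber p q (c + 1)) := by
            rw [← h1, pow_add]; ring
          have hB : p ^ (c + 1) * q ^ l * (s0 * (q ^ l.choose 2 * p ^ (c + 1).choose 2 *
              pqBinom p q (c + l + 1) (c + 1))) + p ^ c * q ^ (l + 1) * (s0 *
              (q ^ (l + 1).choose 2 * p ^ c.choose 2 * pqBinom p q (c + l + 1) c)) =
              s0 * (q ^ (l + 1).choose 2 * p ^ (c + 1).choose 2 *
                pqBinom p q (c + l + 1 + 1) (c + 1)) := by
            rw [h2, e2, e3]; ring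
          rw [hA, hB, e3]
          ring

/-- The generating function of all closed paths is the `p,q`-Stirling number. -/
theorem pathSum_self (n k : ℕ) : pathSum p q n k k = pqStirling p q n k := by
  rw [pathSum_eq, pqStirling_eq_pow_mul_reduced]
  simp [mul_comm]

end Paths

/-! ### Reversal of paths and the symmetry it yields. -/

section Reversal

/-- The image of `S ∩ {0, …, n - 1}` under the reversal `i ↦ n - 1 - i`. -/
def reflectSet (n : ℕ) (S : Finset ℕ) : Finset ℕ :=
  (Finset.range n).filter fun i => n - 1 - i ∈ S

theorem reflectSet_subset (n : ℕ) (S : Finset ℕ) : reflectSet n S ⊆ Finset.range n :=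
  Finset.filter_subset _ _

theorem mem_reflectSet {n : ℕ} {S : Finset ℕ} {i : ℕ} (hi : i < n) :
    n - 1 - i ∈ reflectSet n S ↔ i ∈ S := by
  simp [reflectSet, show n - 1 - i < n by omega, show n - 1 - (n - 1 - i) = i by omega]

theorem reflectSet_reflectSet {n : ℕ} {S : Finset ℕ} (h : S ⊆ Finset.range n) :
    reflectSet n (reflectSet n S) = S := by
  ext i
  constructor
  · intro hi
    have hin := Finset.mem_range.mp (reflectSet_subset _ _ hi)
    exact (mem_reflectSet hin).mp (Finset.mem_filter.mp hi).2
  · intro hi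
    have hin := Finset.mem_range.mp (h hi)
    exact Finset.mem_filter.mpr ⟨h hi, (mem_reflectSet hin).mpr hi⟩

theorem countBelow_reflectSet {n : ℕ} {S : Finset ℕ} (h : S ⊆ Finset.range n) {i : ℕ}
    (hi : i < n) : countBelow (reflectSet n S) (n - 1 - i) = countAbove S i := by
  unfold countBelow countAbove
  refine Finset.card_nbij' (n - 1 - ·) (n - 1 - ·) ?_ ?_ ?_ ?_
  · intro x hx
    simp only [reflectSet, Finset.coe_filter, Finset.mem_filter, Finset.mem_range,
      Set.mem_ofPred_eq] at hx ⊢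
    exact ⟨hx.1.2, by omega⟩
  · intro x hx
    simp only [Finset.coe_filter, Set.mem_ofPred_eq] at hx ⊢
    have := Finset.mem_range.mp (h hx.1)
    exact ⟨(mem_reflectSet this).mpr hx.1, by omega⟩
  · intro x hx
    simp only [reflectSet, Finset.coe_filter, Finset.mem_filter, Finset.mem_range,
      Set.mem_ofPred_eq] at hx
    change n - 1 - (n - 1 - x) = x
    omega
  · intro x hx
    simp only [Finset.coe_filter, Set.mem_ofPred_eq] at hx
    have := Finset.mem_range.mp (h hx.1)
    change n - 1 - (n - 1 - x) = x
    omega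

theorem countAbove_reflectSet {n : ℕ} {S : Finset ℕ} (h : S ⊆ Finset.range n)
    {i : ℕ} (hi : i < n) : countAbove (reflectSet n S) (n - 1 - i) = countBelow S i := by
  rw [← countBelow_reflectSet (reflectSet_subset n S) (by omega),
    reflectSet_reflectSet h, show n - 1 - (n - 1 - i) = i by omega]

theorem card_reflectSet {n : ℕ} {S : Finset ℕ} (h : S ⊆ Finset.range n) :
    (reflectSet n S).card = S.card := by
  refine Finset.card_nbij' (n - 1 - ·) (n - 1 - ·) ?_ ?_ ?_ ?_
  · intro x hx
    exact (Finset.mem_filter.mp hx).2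
  · intro x hx
    exact (mem_reflectSet (Finset.mem_range.mp (h hx))).mpr hx
  · intro x hx
    have := Finset.mem_range.mp (reflectSet_subset _ _ hx)
    change n - 1 - (n - 1 - x) = x
    omega
  · intro x hx
    have := Finset.mem_range.mp (h hx)
    change n - 1 - (n - 1 - x) = x
    omega

theorem reflectSet_mem_powersetCard {n k : ℕ} {S : Finset ℕ}
    (h : S ∈ (Finset.range n).powersetCard k) :
    reflectSet n S ∈ (Finset.range n).powersetCard k := by
  rw [Finset.mem_powersetCard] at h ⊢
  exact ⟨reflectSet_subset n S, by rw [card_reflectSet h.1, h.2]⟩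

variable {K : Type*} [CommSemiring K] (p q : K)

theorem sum_powersetCard_reflectSet {M : Type*} [AddCommMonoid M] (n k : ℕ) (f : Finset ℕ → M) :
    ∑ S ∈ (Finset.range n).powersetCard k, f (reflectSet n S) =
      ∑ S ∈ (Finset.range n).powersetCard k, f S :=
  Finset.sum_nbij' (reflectSet n) (reflectSet n) (fun _ h => reflectSet_mem_powersetCard h)
    (fun _ h => reflectSet_mem_powersetCard h)
    (fun _ h => reflectSet_reflectSet (Finset.mem_powersetCard.mp h).1)
    (fun _ h => reflectSet_reflectSet (Finset.mem_powersetCard.mp h).1) (fun _ _ => rfl)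

/-- Up-steps and down-steps of a nonnegative path from `0` match up level by level. -/
theorem prod_opening_steps_eq_prod_closing_steps (f : ℕ → K) (O C : Finset ℕ) (m : ℕ)
    (h : ∀ i ≤ m, countBelow C i ≤ countBelow O i) :
    ∏ i ∈ Finset.range m, (if i ∈ O ∧ i ∉ C then f (pathHeight O C i + 1) else 1) =
      (∏ i ∈ Finset.range m, if i ∉ O ∧ i ∈ C then f (pathHeight O C i) else 1) *
        ∏ s ∈ Finset.range (pathHeight O C m), f (s + 1) := by
  induction m with
  | zero => simp [pathHeight, countBelow]
  | succ m ih =>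
    rw [Finset.prod_range_succ, Finset.prod_range_succ, ih fun i hi => h i (by omega)]
    have h0 := h m (by omega)
    have h1 := h (m + 1) le_rfl
    rw [countBelow_succ, countBelow_succ] at h1
    have hh : pathHeight O C (m + 1) = countBelow O m + (if m ∈ O then 1 else 0) -
        (countBelow C m + (if m ∈ C then 1 else 0)) := by
      rw [pathHeight, countBelow_succ, countBelow_succ]
    by_cases hO : m ∈ O <;> by_cases hC : m ∈ C <;>
      simp only [hO, hC, if_true, if_false, not_true, not_false_eq_true, and_true, and_false,
        and_self, mul_one, add_zero] at h1 hh ⊢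
    · rw [show pathHeight O C (m + 1) = pathHeight O C m by rw [hh, pathHeight]; omega]
    · rw [show pathHeight O C (m + 1) = pathHeight O C m + 1 by rw [hh, pathHeight]; omega,
        Finset.prod_range_succ]
      ring
    · obtain ⟨l, hl⟩ : ∃ l, pathHeight O C m = l + 1 := ⟨pathHeight O C m - 1, by
        unfold pathHeight; omega⟩
      rw [show pathHeight O C (m + 1) = l by rw [hh]; unfold pathHeight at hl; omega, hl,
        Finset.prod_range_succ]
      ring
    · rw [show pathHeight O C (m + 1) = pathHeight O C m by rw [hh, pathHeight]]

/-- A path that becomes negative has weight zero. -/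
theorem pathWeight_eq_zero {n i : ℕ} {O C : Finset ℕ} (hi : i ≤ n)
    (h : countBelow O i < countBelow C i) : pathWeight p q n O C = 0 := by
  induction i with
  | zero => simp [countBelow] at h
  | succ i ih =>
    by_cases h' : countBelow O i < countBelow C i
    · exact ih (by omega) h'
    · rw [countBelow_succ, countBelow_succ] at h
      refine Finset.prod_eq_zero (Finset.mem_range.mpr (show i < n by omega)) ?_
      have hO : i ∉ O := by intro hO; split_ifs at h <;> omega
      -- The first descent below zero is made by a non-opener at height `0`, whose factor is
      -- `[0]_{p,q} = 0`.
      rw [if_neg hO, pathHeight, show countBelow O i - countBelow C i = 0 by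
        split_ifs at h <;> omega, pqNumber_zero]

/-- As `O` and `C` have the same size, closers minus openers after `i` equals openers minus closers
up to `i`: the reversed path sees the height just after `i`. -/
theorem pathHeight_reflectSet {n k : ℕ} {O C : Finset ℕ}
    (hO : O ∈ (Finset.range n).powersetCard k) (hC : C ∈ (Finset.range n).powersetCard k) {i : ℕ}
    (hi : i < n) : pathHeight (reflectSet n C) (reflectSet n O) (n - 1 - i) =
      countBelow O (i + 1) - countBelow C (i + 1) := by
  rw [Finset.mem_powersetCard] at hO hC
  have h1 := countBelow_add_countAbove O i
  have h2 := countBelow_add_countAbove C i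
  rw [pathHeight, countBelow_reflectSet hO.1 hi, countBelow_reflectSet hC.1 hi]
  omega

/-- For a nonnegative path, reversal turns the factor `q ^ h` of a rise from `h` into `[h + 1]`, and
the factor `[h]` of a fall from `h` into `q ^ (h - 1)`; other letters keep their factors. A path
from `0` to `0` has as many rises as falls between any two adjacent levels, so the products agree.
-/
theorem pathWeight_reflectSet {n k : ℕ} {O C : Finset ℕ}
    (hO : O ∈ (Finset.range n).powersetCard k) (hC : C ∈ (Finset.range n).powersetCard k) :
    pathWeight p q n (reflectSet n C) (reflectSet n O) = pathWeight p q n O C := by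
  have hO' := Finset.mem_powersetCard.mp hO
  have hC' := Finset.mem_powersetCard.mp hC
  by_cases hv : ∀ i ≤ n, countBelow C i ≤ countBelow O i
  · have hend : pathHeight O C n = 0 := by
      rw [pathHeight, countBelow_eq_card hO'.1, countBelow_eq_card hC'.1, hO'.2, hC'.2, Nat.sub_self]
    have key : ∀ f : ℕ → K,
        ∏ i ∈ Finset.range n, (if i ∈ O ∧ i ∉ C then f (pathHeight O C i + 1) else 1) =
          ∏ i ∈ Finset.range n, if i ∉ O ∧ i ∈ C then f (pathHeight O C i) else 1 := by
      intro f
      rw [prod_opening_steps_eq_prod_closing_steps f O C n hv, hend]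
      simp
    set common : ℕ → K := fun i => if i ∈ O ∧ i ∈ C then q ^ pathHeight O C i else
      if i ∉ O ∧ i ∉ C then pqNumber p q (pathHeight O C i) else 1
    have hR : pathWeight p q n (reflectSet n C) (reflectSet n O) =
        ∏ i ∈ Finset.range n, common i *
          (if i ∈ O ∧ i ∉ C then pqNumber p q (pathHeight O C i + 1) else 1) *
          (if i ∉ O ∧ i ∈ C then q ^ (pathHeight O C i - 1) else 1) := by
      rw [pathWeight, ← Finset.prod_range_reflect]
      refine Finset.prod_congr rfl fun i hi => ?_
      rw [Finset.mem_range] at hi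
      have h0 := hv i hi.le
      have h1 := hv (i + 1) hi
      rw [pathHeight_reflectSet hO hC hi, if_congr (mem_reflectSet hi) rfl rfl]
      rw [countBelow_succ, countBelow_succ] at h1 ⊢
      by_cases hiO : i ∈ O <;> by_cases hiC : i ∈ C <;>
        simp only [common, hiO, hiC, if_true, if_false, not_true, not_false_eq_true, and_true,
          and_false, and_self, mul_one, one_mul, add_zero] at h1 ⊢
      · congr 1; unfold pathHeight; omega
      · congr 1; unfold pathHeight; omega
      · congr 1
      · rfl
    have hL : pathWeight p q n O C =
        ∏ i ∈ Finset.range n, common i *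
          (if i ∉ O ∧ i ∈ C then pqNumber p q (pathHeight O C i) else 1) *
          -- The exponent is left as `h + 1 - 1` so that `key` applies with `f s = q ^ (s - 1)`.
          (if i ∈ O ∧ i ∉ C then q ^ (pathHeight O C i + 1 - 1) else 1) := by
      refine Finset.prod_congr rfl fun i hi => ?_
      by_cases hiO : i ∈ O <;> by_cases hiC : i ∈ C <;> simp [common, hiO, hiC]
    rw [hL, hR]
    simp only [Finset.prod_mul_distrib]
    rw [key (pqNumber p q), key fun s => q ^ (s - 1)]
  -- A path that becomes negative has a reversal that does so too, and both weights vanish.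
  · push Not at hv
    obtain ⟨i, hi, hlt⟩ := hv
    rw [pathWeight_eq_zero p q hi hlt]
    have h1 := countBelow_eq_card hO'.1
    have h2 := countBelow_eq_card hC'.1
    rcases Nat.eq_zero_or_pos i with rfl | hpos
    · simp [countBelow] at hlt
    have hin : i - 1 < n := by omega
    have h3 := countBelow_add_countAbove O (i - 1)
    have h4 := countBelow_add_countAbove C (i - 1)
    rw [show i - 1 + 1 = i by omega] at h3 h4
    refine pathWeight_eq_zero p q (i := n - 1 - (i - 1)) (by omega) ?_
    rw [countBelow_reflectSet hO'.1 hin, countBelow_reflectSet hC'.1 hin]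
    omega

/-- The generating function of closed paths that records, with `x`, the number of earlier closers
and, with `y`, the number of later openers of each letter. -/
def bivariatePathSum (x y p q : K) (n k : ℕ) : K :=
  ∑ O ∈ (Finset.range n).powersetCard k, ∑ C ∈ (Finset.range n).powersetCard k,
    x ^ (∑ i ∈ Finset.range n, countBelow C i) * y ^ (∑ i ∈ Finset.range n, countAbove O i) *
      pathWeight p q n O C

/-- Substitute the reflection of `C` for `O` and that of `O` for `C`: earlier closers of a letter
become later openers of its mirror image. -/
theorem bivariatePathSum_comm (x y : K) (n k : ℕ) :
    bivariatePathSum x y p q n k = bivariatePathSum y x p q n k := by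
  unfold bivariatePathSum
  rw [← sum_powersetCard_reflectSet, Finset.sum_congr rfl fun O _ =>
    (sum_powersetCard_reflectSet n k _).symm, Finset.sum_comm]
  refine Finset.sum_congr rfl fun O hO => Finset.sum_congr rfl fun C hC => ?_
  rw [pathWeight_reflectSet p q hO hC, mul_comm (y ^ _)]
  have hO' := (Finset.mem_powersetCard.mp hO).1
  have hC' := (Finset.mem_powersetCard.mp hC).1
  congr 2
  · rw [← Finset.sum_range_reflect]
    exact congrArg _ (Finset.sum_congr rfl fun i hi =>
      countBelow_reflectSet hO' (Finset.mem_range.mp hi))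
  · rw [← Finset.sum_range_reflect]
    exact congrArg _ (Finset.sum_congr rfl fun i hi =>
      countAbove_reflectSet hC' (Finset.mem_range.mp hi))

theorem bivariatePathSum_one_right (n k : ℕ) :
    bivariatePathSum p 1 p q n k = pqStirling p q n k := by
  rw [← pathSum_self]
  simp [bivariatePathSum, pathSum]

end Reversal

/-! ### Words with prescribed openers and closers. -/

section Words

variable {k : ℕ} (o : Fin k → ℕ) (C : Finset ℕ)

/-- The blocks that are open just before the letter `i` of the word `w`, when the block `b` is
opened by the letter `o b` and the letters in `C` are closers. -/
def openBlocks {m : ℕ} (w : Fin m → Fin k) (i : ℕ) : Finset (Fin k) :=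
  Finset.univ.filter fun b => o b < i ∧ ∀ j : Fin m, (j : ℕ) < i → (j : ℕ) ∈ C → w j ≠ b

/-- The word `w` assigns each letter to the block that it opens or to a block that is open. -/
def IsBlockWord {m : ℕ} (w : Fin m → Fin k) : Prop :=
  ∀ i : Fin m, o (w i) ≤ i ∧ ((i : ℕ) ∈ Finset.univ.image o → o (w i) = i) ∧
    ∀ j < i, (j : ℕ) ∈ C → w j ≠ w i

instance {m : ℕ} (w : Fin m → Fin k) : Decidable (IsBlockWord o C w) :=
  inferInstanceAs (Decidable (∀ i : Fin m, o (w i) ≤ i ∧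
    ((i : ℕ) ∈ Finset.univ.image o → o (w i) = i) ∧ ∀ j < i, (j : ℕ) ∈ C → w j ≠ w i))

variable {K : Type*} [CommSemiring K] (p q : K)

/-- The weight of the letter `i` put into the block `b`. -/
def letterWeight {m : ℕ} (w : Fin m → Fin k) (i : ℕ) (b : Fin k) : K :=
  if i ∈ Finset.univ.image o then 1 else
    p ^ ((openBlocks o C w i).filter fun c => b < c).card *
      q ^ ((openBlocks o C w i).filter fun c => c < b).card

theorem openBlocks_snoc {m : ℕ} (w : Fin m → Fin k) (b : Fin k) {i : ℕ} (hi : i ≤ m) :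
    openBlocks o C (Fin.snoc (α := fun _ => Fin k) w b) i = openBlocks o C w i := by
  ext c
  simp only [openBlocks, Finset.mem_filter, Finset.mem_univ, true_and, Fin.forall_fin_succ',
    Fin.snoc_castSucc, Fin.snoc_last, Fin.val_castSucc, Fin.val_last]
  constructor
  · exact fun h => ⟨h.1, h.2.1⟩
  · exact fun h => ⟨h.1, h.2, fun h' => by omega⟩

theorem letterWeight_snoc {m : ℕ} (w : Fin m → Fin k) (b c : Fin k) {i : ℕ} (hi : i ≤ m) :
    letterWeight o C p q (Fin.snoc (α := fun _ => Fin k) w b) i c = letterWeight o C p q w i c := by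
  unfold letterWeight
  rw [openBlocks_snoc o C w b hi]

theorem isBlockWord_snoc {m : ℕ} (w : Fin m → Fin k) (b : Fin k) :
    IsBlockWord o C (Fin.snoc (α := fun _ => Fin k) w b) ↔ IsBlockWord o C w ∧
      (o b ≤ m ∧ (m ∈ Finset.univ.image o → o b = m) ∧ ∀ j : Fin m, (j : ℕ) ∈ C → w j ≠ b) := by
  simp only [IsBlockWord, Fin.forall_fin_succ', Fin.snoc_castSucc, Fin.snoc_last, Fin.val_castSucc,
    Fin.val_last, Fin.castSucc_lt_castSucc_iff, Fin.castSucc_lt_last, forall_const,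
    lt_irrefl, IsEmpty.forall_iff, and_true]
  refine and_congr_left fun _ => forall_congr' fun i => and_congr_right fun _ =>
    and_congr_right fun _ => ⟨fun h => h.1, fun h => ⟨h, fun h' => ?_⟩⟩
  exact absurd h' (Fin.castSucc_lt_last i).not_gt

variable {o C}

/-- In a block word distinct closers lie in distinct blocks, each already opened, so the blocks
closed before `i` are equinumerous with the closers below `i`. -/
theorem card_openBlocks (ho : Function.Injective o) {m : ℕ}
    {w : Fin m → Fin k} (hw : IsBlockWord o C w) {i : ℕ} (hi : i ≤ m) :
    (openBlocks o C w i).card = pathHeight (Finset.univ.image o) C i := by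
  classical
  set D : Finset (Fin k) := (Finset.univ.filter fun j : Fin m => (j : ℕ) < i ∧ (j : ℕ) ∈ C).image w
  have hD : openBlocks o C w i = (Finset.univ.filter fun b => o b < i) \ D := by
    ext b
    simp only [openBlocks, D, Finset.mem_filter, Finset.mem_univ, true_and, Finset.mem_sdiff,
      Finset.mem_image, not_exists, not_and, and_imp]
  have hsub : D ⊆ Finset.univ.filter fun b => o b < i := by
    intro b hb
    obtain ⟨j, hj, rfl⟩ := Finset.mem_image.mp hb
    have := (hw j).1
    have := (Finset.mem_filter.mp hj).2.1
    exact Finset.mem_filter.mpr ⟨Finset.mem_univ _, by omega⟩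
  rw [hD, Finset.card_sdiff_of_subset hsub, pathHeight]
  congr 1
  · rw [countBelow, Finset.filter_image, Finset.card_image_of_injective _ ho]
  · rw [Finset.card_image_of_injOn, countBelow]
    · refine Finset.card_bij (fun j _ => (j : ℕ)) ?_ ?_ ?_
      · intro j hj
        simp at hj ⊢
        exact ⟨hj.2, hj.1⟩
      · intro a _ b _ h
        exact Fin.ext h
      · intro j hj
        simp only [Finset.mem_filter] at hj
        exact ⟨⟨j, by omega⟩, by simp [hj], rfl⟩
    · intro a ha b hb hab
      simp at ha hb
      rcases lt_trichotomy a b with h | h | h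
      · exact absurd hab ((hw b).2.2 a h ha.2)
      · exact h
      · exact absurd hab.symm ((hw a).2.2 b h hb.2)

theorem sum_snoc {α M : Type*} [Fintype α] [AddCommMonoid M] {m : ℕ}
    (f : (Fin (m + 1) → α) → M) :
    ∑ w, f w = ∑ w : Fin m → α, ∑ b, f (Fin.snoc (α := fun _ => α) w b) := by
  rw [← (Fin.snocEquiv fun _ => α).sum_comp, Fintype.sum_prod_type, Finset.sum_comm]
  rfl

/-- Summing over all words with given openers and closers, every letter that is not an opener
independently contributes a factor `[h]_{p,q}`, where `h` is the number of open blocks. -/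
theorem sum_blockWords (ho : Function.Injective o) (m : ℕ) :
    ∑ w : Fin m → Fin k, (if IsBlockWord o C w then ∏ i : Fin m, letterWeight o C p q w i (w i)
      else 0) =
    ∏ i ∈ Finset.range m, if i ∈ Finset.univ.image o then 1 else
      pqNumber p q (pathHeight (Finset.univ.image o) C i) := by
  induction m with
  | zero => simp [IsBlockWord]
  | succ m ih =>
    rw [Finset.prod_range_succ, ← ih, sum_snoc, Finset.sum_mul]
    refine Finset.sum_congr rfl fun w _ => ?_
    simp only [isBlockWord_snoc, Fin.prod_univ_castSucc, Fin.snoc_castSucc,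
      Fin.snoc_last, Fin.val_castSucc, Fin.val_last]
    by_cases hw : IsBlockWord o C w
    swap
    · simp [hw]
    have hlw : ∀ b : Fin k, ∀ i : Fin m,
        letterWeight o C p q (Fin.snoc (α := fun _ => Fin k) w b) i (w i) =
          letterWeight o C p q w i (w i) := fun b i => letterWeight_snoc o C p q w b _ i.2.le
    simp only [hw, true_and, if_true, hlw, letterWeight_snoc o C p q w _ _ le_rfl]
    simp only [← mul_ite_zero, ← Finset.mul_sum]
    congr 1
    rw [← Finset.sum_filter]
    -- An opener has only one admissible block; a non-opener may join any open block.
    by_cases hm : m ∈ Finset.univ.image o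
    · obtain ⟨b, -, hb⟩ := Finset.mem_image.mp hm
      rw [if_pos hm, Finset.sum_eq_single b]
      · simp [letterWeight, hm]
      · intro c hc hcb
        exact absurd (ho ((Finset.mem_filter.mp hc).2.2.1 hm |>.trans hb.symm)) hcb
      · intro h
        refine absurd (Finset.mem_filter.mpr ⟨Finset.mem_univ _, hb.le, fun _ => hb, ?_⟩) h
        rintro j - rfl
        have := (hw j).1
        omega
    · rw [if_neg hm, ← card_openBlocks ho hw le_rfl,
        ← sum_pow_card_above_mul_pow_card_below p q]
      refine Finset.sum_congr ?_ fun b _ => by simp only [letterWeight, hm, if_false]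
      ext b
      simp only [openBlocks, Finset.mem_filter, Finset.mem_univ, true_and, hm, IsEmpty.forall_iff]
      refine and_congr ⟨fun h => ?_, le_of_lt⟩ ⟨fun h j _ => h j, fun h j => h j j.2⟩
      refine lt_of_le_of_ne h fun h' => hm ?_
      exact Finset.mem_image.mpr ⟨b, Finset.mem_univ _, h'⟩

end Words

/-! ### Decomposition of the statistics of a `σ`-partition. -/

theorem countBelow_image {k : ℕ} {o : Fin k → ℕ} (ho : Function.Injective o) (i : ℕ) :
    countBelow (Finset.univ.image o) i = (Finset.univ.filter fun b => o b < i).card := by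
  rw [countBelow, Finset.filter_image, Finset.card_image_of_injective _ ho]

theorem countAbove_image {k : ℕ} {o : Fin k → ℕ} (ho : Function.Injective o) (i : ℕ) :
    countAbove (Finset.univ.image o) i = (Finset.univ.filter fun b => i < o b).card := by
  rw [countAbove, Finset.filter_image, Finset.card_image_of_injective _ ho]

namespace OrderedPartition

variable {n k : ℕ} (π : OrderedPartition n k)

theorem mem_block {i : Fin n} {b : Fin k} : i ∈ π.block b ↔ π.idx i = b := by simp [block]

@[simp] theorem idx_opener (b : Fin k) : π.idx (π.opener b) = b :=
  π.mem_block.mp (Finset.min'_mem _ _)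

@[simp] theorem idx_closer (b : Fin k) : π.idx (π.closer b) = b :=
  π.mem_block.mp (Finset.max'_mem _ _)

theorem opener_le {i : Fin n} {b : Fin k} (h : π.idx i = b) : π.opener b ≤ i :=
  Finset.min'_le _ _ (π.mem_block.mpr h)

theorem le_closer {i : Fin n} {b : Fin k} (h : π.idx i = b) : i ≤ π.closer b :=
  Finset.le_max' _ _ (π.mem_block.mpr h)

theorem opener_le_closer (b : Fin k) : π.opener b ≤ π.closer b := π.le_closer (π.idx_opener b)

theorem opener_injective : Function.Injective π.opener :=
  Function.LeftInverse.injective π.idx_opener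

theorem closer_injective : Function.Injective π.closer :=
  Function.LeftInverse.injective π.idx_closer

/-- The openers, as a set of natural numbers. -/
def openerSet : Finset ℕ := Finset.univ.image fun b => (π.opener b : ℕ)

/-- The closers, as a set of natural numbers. -/
def closerSet : Finset ℕ := Finset.univ.image fun b => (π.closer b : ℕ)

theorem openerSet_mem_powersetCard : π.openerSet ∈ (Finset.range n).powersetCard k := by
  rw [Finset.mem_powersetCard, openerSet,
    Finset.card_image_of_injective _ fun _ _ h => π.opener_injective (Fin.val_injective h),
    Finset.card_fin]
  exact ⟨Finset.image_subset_iff.mpr fun b _ => Finset.mem_range.mpr (π.opener b).2, rfl⟩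

theorem closerSet_mem_powersetCard : π.closerSet ∈ (Finset.range n).powersetCard k := by
  rw [Finset.mem_powersetCard, closerSet,
    Finset.card_image_of_injective _ fun _ _ h => π.closer_injective (Fin.val_injective h),
    Finset.card_fin]
  exact ⟨Finset.image_subset_iff.mpr fun b _ => Finset.mem_range.mpr (π.closer b).2, rfl⟩

theorem countBelow_openerSet (i : Fin n) :
    countBelow π.openerSet i = (Finset.univ.filter fun b => π.opener b < i).card :=
  countBelow_image (Fin.val_injective.comp π.opener_injective) i

theorem countBelow_closerSet (i : Fin n) :
    countBelow π.closerSet i = (Finset.univ.filter fun b => π.closer b < i).card :=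
  countBelow_image (Fin.val_injective.comp π.closer_injective) i

theorem countAbove_openerSet (i : Fin n) :
    countAbove π.openerSet i = (Finset.univ.filter fun b => i < π.opener b).card :=
  countAbove_image (Fin.val_injective.comp π.opener_injective) i

theorem mem_openerSet {i : Fin n} : (i : ℕ) ∈ π.openerSet ↔ ∃ b, π.opener b = i := by
  simp [openerSet, Fin.ext_iff]

theorem mem_closerSet {i : Fin n} : (i : ℕ) ∈ π.closerSet ↔ ∃ b, π.closer b = i := by
  simp [closerSet, Fin.ext_iff]

/-- The number of blocks to the right of the block containing `i` that are open at `i`. -/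
def rsbAt (i : Fin n) : ℕ :=
  (Finset.univ.filter fun b : Fin k => π.idx i < b ∧ π.opener b < i ∧ i < π.closer b).card

theorem card_filter_openers (P : Fin n → Prop) [DecidablePred P] :
    (π.openers.filter P).card = (Finset.univ.filter fun b => P (π.opener b)).card := by
  rw [openers, Finset.filter_image, Finset.card_image_of_injective _ π.opener_injective]

theorem card_filter_closers (P : Fin n → Prop) [DecidablePred P] :
    (π.closers.filter P).card = (Finset.univ.filter fun b => P (π.closer b)).card := by
  rw [closers, Finset.filter_image, Finset.card_image_of_injective _ π.closer_injective]

theorem closer_ne_of_idx_ne {i : Fin n} {b : Fin k} (h : π.idx i ≠ b) : π.closer b ≠ i := by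
  rintro rfl; simp at h

theorem opener_ne_of_idx_ne {i : Fin n} {b : Fin k} (h : π.idx i ≠ b) : π.opener b ≠ i := by
  rintro rfl; simp at h

/-- A block to the right opened before `i` is either still open at `i` or closed before `i`. The
latter, with the left blocks counted by `lcsAt`, are all the blocks closed before `i`. -/
theorem rosAt_add_lcsAt (i : Fin n) :
    π.rosAt i + π.lcsAt i = π.rsbAt i + countBelow π.closerSet i := by
  rw [rosAt, lcsAt, rsbAt, card_filter_openers, card_filter_closers, countBelow_closerSet]
  simp only [idx_opener, idx_closer, Finset.card_filter, ← Finset.sum_add_distrib]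
  refine Finset.sum_congr rfl fun b _ => ?_
  have h1 := π.opener_le_closer b
  have h2 := π.closer_ne_of_idx_ne (i := i) (b := b)
  have h3 := π.le_closer (i := i) (b := b)
  grind

/-- Dually, a block to the right closing after `i` is either open at `i` or opens later. -/
theorem lobAt_add_rcbAt (i : Fin n) :
    π.lobAt i + π.rcbAt i = π.rsbAt i + countAbove π.openerSet i := by
  rw [lobAt, rcbAt, rsbAt, card_filter_openers, card_filter_closers, countAbove_openerSet]
  simp only [idx_opener, idx_closer, Finset.card_filter, ← Finset.sum_add_distrib]
  refine Finset.sum_congr rfl fun b _ => ?_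
  have h1 := π.opener_le_closer b
  have h2 := π.opener_ne_of_idx_ne (i := i) (b := b)
  have h3 := π.opener_le (i := i) (b := b)
  grind

theorem mak_eq : π.mak = ∑ i, π.rsbAt i + ∑ i ∈ Finset.range n, countBelow π.closerSet i := by
  rw [mak, ros, lcs, Finset.sum_range, ← Finset.sum_add_distrib, ← Finset.sum_add_distrib]
  exact Finset.sum_congr rfl fun i _ => π.rosAt_add_lcsAt i

theorem mak'_eq : π.mak' = ∑ i, π.rsbAt i + ∑ i ∈ Finset.range n, countAbove π.openerSet i := by
  rw [mak', lob, rcb, Finset.sum_range, ← Finset.sum_add_distrib, ← Finset.sum_add_distrib]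
  exact Finset.sum_congr rfl fun i _ => π.lobAt_add_rcbAt i

theorem sum_ite_mem_openerSet (g : Fin n → ℕ) :
    ∑ i : Fin n, (if (i : ℕ) ∈ π.openerSet then g i else 0) = ∑ b, g (π.opener b) := by
  rw [← Finset.sum_filter, ← Finset.sum_image (f := g) π.opener_injective.injOn]
  refine Finset.sum_congr ?_ fun _ _ => rfl
  ext i
  simp [mem_openerSet]

theorem sum_eq_sum_openers_add (g : Fin n → ℕ) :
    ∑ i, g i = ∑ b, g (π.opener b) +
      ∑ i : Fin n, (if (i : ℕ) ∈ π.openerSet then 0 else g i) := by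
  rw [← sum_ite_mem_openerSet, ← Finset.sum_add_distrib]
  refine Finset.sum_congr rfl fun i _ => ?_
  split_ifs <;> simp

theorem isSigmaPartition_iff (σ : Equiv.Perm (Fin k)) :
    π.IsSigmaPartition σ ↔ StrictMono fun c => π.opener (σ.symm c) := by
  constructor
  · rintro ⟨π₀, h₀, h⟩
    have : (fun c => π.opener (σ.symm c)) = π₀.opener := by
      funext c
      simp [opener, h]
    rwa [this]
  · intro hmono
    -- The only candidate: the block at position `b` moves to position `σ b`.
    let π₀ : OrderedPartition n k := ⟨σ ∘ π.1, σ.surjective.comp π.2⟩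
    have h : ∀ b, π.block b = π₀.block (σ b) := fun b => by
      ext i; simp [mem_block, idx, π₀]
    refine ⟨π₀, ?_, h⟩
    have : (fun c => π.opener (σ.symm c)) = π₀.opener := by
      funext c
      simp [opener, h]
    rwa [IsStandard, ← this]

variable {π} {σ : Equiv.Perm (Fin k)}

theorem IsSigmaPartition.opener_lt_opener (h : π.IsSigmaPartition σ) {a b : Fin k} :
    π.opener a < π.opener b ↔ σ a < σ b := by
  have := ((π.isSigmaPartition_iff σ).mp h).lt_iff_lt (a := σ a) (b := σ b)
  simpa using this

theorem card_filter_fin_prod (P : Fin k → Fin k → Prop) [∀ a b, Decidable (P a b)] :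
    (Finset.univ.filter fun ab : Fin k × Fin k => P ab.1 ab.2).card =
      ∑ a, ∑ b, if P a b then 1 else 0 := by
  rw [Finset.card_filter, Fintype.sum_prod_type]

/-- An inversion `a < b` of `σ` says that block `b` opens before block `a`. When `a` opens, `b` is
either still open, counted by `rsbAt`, or already closed, a block inversion. -/
theorem IsSigmaPartition.sum_rsbAt_opener_add_bInv (h : π.IsSigmaPartition σ) :
    ∑ b, π.rsbAt (π.opener b) + π.bInv = permInv σ := by
  rw [bInv, permInv, card_filter_fin_prod (fun a b => a < b ∧ π.closer b < π.opener a),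
    card_filter_fin_prod (fun a b => a < b ∧ σ b < σ a), ← Finset.sum_add_distrib]
  refine Finset.sum_congr rfl fun a _ => ?_
  rw [rsbAt, Finset.card_filter, ← Finset.sum_add_distrib]
  refine Finset.sum_congr rfl fun b _ => ?_
  simp only [idx_opener, ← h.opener_lt_opener]
  have h1 := π.opener_le_closer b
  have h2 := π.closer_ne_of_idx_ne (i := π.opener a) (b := b)
  rw [idx_opener] at h2
  grind

/-- Here `i ≤ π.closer b` is weak, so the block of a non-opener `i` counts as open. -/
theorem pathHeight_eq (π : OrderedPartition n k) (i : Fin n) :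
    pathHeight π.openerSet π.closerSet i =
      (Finset.univ.filter fun b => π.opener b < i ∧ i ≤ π.closer b).card := by
  rw [pathHeight, countBelow_openerSet, countBelow_closerSet, Nat.sub_eq_iff_eq_add]
  · simp only [Finset.card_filter, ← Finset.sum_add_distrib]
    refine Finset.sum_congr rfl fun b _ => ?_
    have h1 := π.opener_le_closer b
    grind
  · refine Finset.card_le_card fun b hb => ?_
    simp only [Finset.mem_filter, Finset.mem_univ, true_and] at hb ⊢
    exact (π.opener_le_closer b).trans_lt hb

/-- At an opener the height counts the open blocks on the left (`lsbAt`) and on the right; the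
latter, together with block inversions, make up the inversions of `σ`. -/
theorem IsSigmaPartition.sum_lsbAt_opener_add_permInv (h : π.IsSigmaPartition σ) :
    ∑ b, π.lsbAt (π.opener b) + permInv σ =
      ∑ b, pathHeight π.openerSet π.closerSet (π.opener b) + π.bInv := by
  rw [bInv, permInv, card_filter_fin_prod (fun a b => a < b ∧ π.closer b < π.opener a),
    card_filter_fin_prod (fun a b => a < b ∧ σ b < σ a), ← Finset.sum_add_distrib,
    ← Finset.sum_add_distrib]
  refine Finset.sum_congr rfl fun a _ => ?_
  rw [pathHeight_eq, lsbAt, Finset.card_filter, Finset.card_filter, ← Finset.sum_add_distrib,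
    ← Finset.sum_add_distrib]
  refine Finset.sum_congr rfl fun b _ => ?_
  simp only [idx_opener, ← h.opener_lt_opener]
  have h1 := π.opener_le_closer b
  have h2 := π.closer_ne_of_idx_ne (i := π.opener a) (b := b)
  rw [idx_opener] at h2
  have h3 : a = b → π.opener a = π.opener b := fun h => by rw [h]
  grind

theorem IsSigmaPartition.mak_add_bInv (h : π.IsSigmaPartition σ) :
    π.mak + π.bInv = ∑ i ∈ Finset.range n, countBelow π.closerSet i + permInv σ +
      ∑ i : Fin n, (if (i : ℕ) ∈ π.openerSet then 0 else π.rsbAt i) := by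
  rw [mak_eq, π.sum_eq_sum_openers_add, ← h.sum_rsbAt_opener_add_bInv]
  ring

theorem IsSigmaPartition.mak'_add_bInv (h : π.IsSigmaPartition σ) :
    π.mak' + π.bInv = ∑ i ∈ Finset.range n, countAbove π.openerSet i + permInv σ +
      ∑ i : Fin n, (if (i : ℕ) ∈ π.openerSet then 0 else π.rsbAt i) := by
  rw [mak'_eq, π.sum_eq_sum_openers_add, ← h.sum_rsbAt_opener_add_bInv]
  ring

/-- The `bInv` subtracted in `cbInv` cancels the one produced by the openers. Adding `permInv σ` on
the left keeps the identity free of subtraction. -/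
theorem IsSigmaPartition.cinvLSB_add_permInv (h : π.IsSigmaPartition σ) :
    π.cinvLSB + permInv σ = k * (k - 1) +
      ∑ i : Fin n, (if (i : ℕ) ∈ π.openerSet then pathHeight π.openerSet π.closerSet i else 0) +
      ∑ i : Fin n, (if (i : ℕ) ∈ π.openerSet then 0 else π.lsbAt i) := by
  have h1 := h.sum_lsbAt_opener_add_permInv
  have h2 := π.bInv_le_choose
  have h3 : k * (k - 1) = k.choose 2 + k.choose 2 := by
    rw [← two_mul, Nat.choose_two_right, Nat.mul_div_cancel' (Nat.even_mul_pred_self k).two_dvd]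
  rw [π.sum_ite_mem_openerSet fun i => pathHeight π.openerSet π.closerSet i, cinvLSB, cbInv, lsb,
    π.sum_eq_sum_openers_add, h3]
  omega

/-! ### From `σ`-partitions to block words and weighted paths. -/

/-- A block word is the word of an ordered partition with prescribed openers and closers. -/
theorem isBlockWord_iff {o : Fin k → ℕ} {C : Finset ℕ} (ho : Function.Injective o)
    (hon : ∀ b, o b < n) (hC : C ∈ (Finset.range n).powersetCard k) (π : OrderedPartition n k) :
    IsBlockWord o C π.1 ↔ (∀ b, (π.opener b : ℕ) = o b) ∧ π.closerSet = C := by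
  rw [Finset.mem_powersetCard] at hC
  constructor
  · intro h
    refine ⟨fun b => le_antisymm ?_ ?_, ?_⟩
    · have hb : π.idx ⟨o b, hon b⟩ = b :=
        ho ((h ⟨o b, hon b⟩).2.1 (Finset.mem_image_of_mem o (Finset.mem_univ b)))
      exact π.opener_le hb
    · have hb := (h (π.opener b)).1
      rwa [show π.1 (π.opener b) = b from π.idx_opener b] at hb
    · refine (Finset.eq_of_subset_of_card_le (fun j hj => ?_) ?_).symm
      · have hjn := Finset.mem_range.mp (hC.1 hj)
        rw [show j = ((⟨j, hjn⟩ : Fin n) : ℕ) from rfl, mem_closerSet]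
        refine ⟨π.idx ⟨j, hjn⟩, (eq_of_le_of_not_lt (π.le_closer rfl) fun hlt => ?_).symm⟩
        exact (h _).2.2 _ hlt hj (π.idx_closer _).symm
      · rw [hC.2, (Finset.mem_powersetCard.mp π.closerSet_mem_powersetCard).2]
  · rintro ⟨hopen, rfl⟩ i
    refine ⟨?_, fun hi => ?_, fun j hj hjC hji => ?_⟩
    · rw [← hopen]
      exact π.opener_le rfl
    · obtain ⟨b, -, hb⟩ := Finset.mem_image.mp hi
      rw [← hopen b] at hb
      have hib : π.opener b = i := Fin.ext hb
      rw [← hb, ← hib, show π.1 (π.opener b) = b from π.idx_opener b, hopen]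
    · obtain ⟨b, rfl⟩ := π.mem_closerSet.mp hjC
      exact hj.not_ge (π.le_closer (hji.symm.trans (π.idx_closer b)))

theorem surjective_of_isBlockWord {o : Fin k → ℕ} {C : Finset ℕ} (ho : Function.Injective o)
    (hon : ∀ b, o b < n) {w : Fin n → Fin k} (h : IsBlockWord o C w) : Function.Surjective w :=
  fun b => ⟨⟨o b, hon b⟩,
    ho ((h ⟨o b, hon b⟩).2.1 (Finset.mem_image_of_mem o (Finset.mem_univ b)))⟩

/-- The open blocks at `i` other than that of `i` cannot close at `i`, so those to its right and
left are the ones counted by `rsbAt` and `lsbAt`. -/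
theorem letterWeight_eq {K : Type*} [CommSemiring K] (p q : K) (π : OrderedPartition n k)
    (i : Fin n) :
    letterWeight (fun b => (π.opener b : ℕ)) π.closerSet p q π.1 i (π.idx i) =
      if (i : ℕ) ∈ π.openerSet then 1 else p ^ π.rsbAt i * q ^ π.lsbAt i := by
  have hopen : ∀ b, b ∈ openBlocks (fun b => (π.opener b : ℕ)) π.closerSet π.1 i ↔
      π.opener b < i ∧ i ≤ π.closer b := by
    intro b
    simp only [openBlocks, Finset.mem_filter, Finset.mem_univ, true_and, Fin.val_fin_lt]
    refine and_congr_right fun _ => ⟨fun h => ?_, fun h j hj hjC hjb => ?_⟩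
    · by_contra hlt
      exact h _ (not_le.mp hlt) (π.mem_closerSet.mpr ⟨b, rfl⟩) (π.idx_closer b)
    · obtain ⟨c, rfl⟩ := π.mem_closerSet.mp hjC
      rw [show π.1 (π.closer c) = c from π.idx_closer c] at hjb
      subst hjb
      exact hj.not_ge h
  have hne : ∀ b, π.idx i ≠ b → (i ≤ π.closer b ↔ i < π.closer b) := fun b hb =>
    ⟨fun h => lt_of_le_of_ne h (π.closer_ne_of_idx_ne hb).symm, le_of_lt⟩
  unfold letterWeight
  refine if_congr Iff.rfl rfl ?_
  congr 3
  · ext b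
    simp only [Finset.mem_filter, Finset.mem_univ, true_and, hopen]
    constructor
    · exact fun h => ⟨h.2, h.1.1, (hne b h.2.ne).mp h.1.2⟩
    · exact fun h => ⟨⟨h.2.1, h.2.2.le⟩, h.1⟩
  · ext b
    simp only [Finset.mem_filter, Finset.mem_univ, true_and, hopen]
    constructor
    · exact fun h => ⟨h.2, h.1.1, (hne b h.2.ne').mp h.1.2⟩
    · exact fun h => ⟨⟨h.2.1, h.2.2.le⟩, h.1⟩

/-- The `p,q`-count of the `σ`-partitions with given openers and closers. -/
theorem sum_prod_letterWeight {K : Type*} [CommSemiring K] (p q : K) {O C : Finset ℕ}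
    (hO : O ∈ (Finset.range n).powersetCard k) (hC : C ∈ (Finset.range n).powersetCard k) :
    ∑ π ∈ (sigmaPartitions n k σ).filter (fun π => (π.openerSet, π.closerSet) = (O, C)),
      ∏ i : Fin n, (if (i : ℕ) ∈ π.openerSet then 1 else p ^ π.rsbAt i * q ^ π.lsbAt i) =
    ∏ i ∈ Finset.range n, if i ∈ O then 1 else pqNumber p q (pathHeight O C i) := by
  have hO' := Finset.mem_powersetCard.mp hO
  -- In a `σ`-partition with opener set `O`, position `b` must be opened by the element of `O` of
  -- rank `σ b`.
  set o : Fin k → ℕ := fun b => O.orderEmbOfFin hO'.2 (σ b)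
  have ho : Function.Injective o := (O.orderEmbOfFin hO'.2).injective.comp σ.injective
  have hoO : Finset.univ.image o = O := by
    refine Finset.eq_of_subset_of_card_le
      (Finset.image_subset_iff.mpr fun b _ => O.orderEmbOfFin_mem hO'.2 _) ?_
    rw [Finset.card_image_of_injective _ ho, Finset.card_fin, hO'.2]
  have hon : ∀ b, o b < n := fun b =>
    Finset.mem_range.mp (hO'.1 (O.orderEmbOfFin_mem hO'.2 _))
  have hmem : ∀ π : OrderedPartition n k,
      π ∈ (sigmaPartitions n k σ).filter (fun π => (π.openerSet, π.closerSet) = (O, C)) ↔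
        IsBlockWord o C π.1 := by
    intro π
    rw [isBlockWord_iff ho hon hC, Finset.mem_filter, sigmaPartitions, Finset.mem_filter,
      Prod.mk.injEq, ← and_assoc]
    refine and_congr_left fun _ => ?_
    rw [isSigmaPartition_iff]
    constructor
    · rintro ⟨⟨-, hmono⟩, hop⟩ b
      have := Finset.orderEmbOfFin_unique hO'.2 (f := fun c => (π.opener (σ.symm c) : ℕ))
        (fun c => hop ▸ Finset.mem_image_of_mem _ (Finset.mem_univ _)) hmono
      simpa using congrFun this (σ b)
    · intro h
      refine ⟨⟨Finset.mem_univ _, fun c d hcd => ?_⟩, ?_⟩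
      · rw [Fin.lt_def, h, h]
        simpa [o] using hcd
      · rw [← hoO, openerSet]
        exact Finset.image_congr fun b _ => h b
  have hsum := sum_blockWords (C := C) p q ho n
  rw [hoO] at hsum
  rw [← hsum, ← Finset.sum_filter]
  refine Finset.sum_bij (fun π _ => π.1) (fun π hπ => ?_) (fun π _ ρ _ h => Subtype.ext h)
    (fun w hw => ?_) (fun π hπ => ?_)
  · exact Finset.mem_filter.mpr ⟨Finset.mem_univ _, (hmem π).mp hπ⟩
  · have hw' := (Finset.mem_filter.mp hw).2
    exact ⟨⟨w, surjective_of_isBlockWord ho hon hw'⟩, (hmem _).mpr hw', rfl⟩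
  · obtain ⟨h1, rfl⟩ := (isBlockWord_iff ho hon hC π).mp ((hmem π).mp hπ)
    rw [← show (fun b => (π.opener b : ℕ)) = o from funext h1]
    exact Finset.prod_congr rfl fun i _ => (letterWeight_eq p q π i).symm

/-- The joint generating function of `(MAK + bInv, MAK' + bInv, cinvLSB)`. -/
theorem sum_sigmaPartitions {K : Type*} [CommSemiring K] (x y z : K) (σ : Equiv.Perm (Fin k)) :
    ∑ π ∈ sigmaPartitions n k σ,
      x ^ (π.mak + π.bInv) * y ^ (π.mak' + π.bInv) * z ^ (π.cinvLSB + permInv σ) =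
    z ^ (k * (k - 1)) * (x * y) ^ permInv σ * bivariatePathSum x y (x * y) z n k := by
  rw [← Finset.sum_fiberwise_of_maps_to (g := fun π => (π.openerSet, π.closerSet))
    (t := (Finset.range n).powersetCard k ×ˢ (Finset.range n).powersetCard k)
    fun π _ => Finset.mem_product.mpr ⟨π.openerSet_mem_powersetCard, π.closerSet_mem_powersetCard⟩,
    Finset.sum_product, bivariatePathSum, Finset.mul_sum]
  refine Finset.sum_congr rfl fun O hO => ?_
  rw [Finset.mul_sum]
  refine Finset.sum_congr rfl fun C hC => ?_
  -- The base is `x * y` because `rsbAt` enters both `MAK` and `MAK'`.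
  have hw : pathWeight (x * y) z n O C =
      z ^ (∑ i : Fin n, if (i : ℕ) ∈ O then pathHeight O C i else 0) *
      ∏ i ∈ Finset.range n, if i ∈ O then 1 else pqNumber (x * y) z (pathHeight O C i) := by
    rw [← Finset.sum_range fun i => if i ∈ O then pathHeight O C i else 0,
      ← Finset.prod_pow_eq_pow_sum, ← Finset.prod_mul_distrib]
    refine Finset.prod_congr rfl fun i _ => ?_
    split_ifs <;> simp
  rw [hw, ← sum_prod_letterWeight (σ := σ) (x * y) z hO hC, Finset.mul_sum, Finset.mul_sum,
    Finset.mul_sum]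
  refine Finset.sum_congr rfl fun π hπ => ?_
  obtain ⟨h1, h2⟩ := Finset.mem_filter.mp hπ
  have hσ : π.IsSigmaPartition σ := (Finset.mem_filter.mp h1).2
  obtain ⟨rfl, rfl⟩ := Prod.mk.injEq _ _ _ _ |>.mp h2
  have hprod : ∏ i : Fin n,
      (if (i : ℕ) ∈ π.openerSet then 1 else (x * y) ^ π.rsbAt i * z ^ π.lsbAt i) =
      (x * y) ^ (∑ i : Fin n, if (i : ℕ) ∈ π.openerSet then 0 else π.rsbAt i) *
      z ^ (∑ i : Fin n, if (i : ℕ) ∈ π.openerSet then 0 else π.lsbAt i) := by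
    rw [← Finset.prod_pow_eq_pow_sum, ← Finset.prod_pow_eq_pow_sum, ← Finset.prod_mul_distrib]
    refine Finset.prod_congr rfl fun i _ => ?_
    split_ifs <;> simp
  rw [hprod, hσ.mak_add_bInv, hσ.mak'_add_bInv, hσ.cinvLSB_add_permInv]
  simp only [pow_add, mul_pow]
  ring

end OrderedPartition

/-! ### Equidistribution and the Stirling formula. -/

/-- Two triples of statistics whose first components are swapped are equidistributed as soon as
their generating functions agree. -/
theorem card_filter_eq_of_sum_pow_eq {α : Type*} (s : Finset α) (f g h : α → ℕ)
    (H : ∀ x y z : MvPolynomial (Fin 3) ℕ, ∑ a ∈ s, x ^ f a * y ^ g a * z ^ h a =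
      ∑ a ∈ s, x ^ g a * y ^ f a * z ^ h a) (t : ℕ × ℕ × ℕ) :
    (s.filter fun a => (f a, g a, h a) = t).card =
      (s.filter fun a => (g a, f a, h a) = t).card := by
  have hmon : ∀ a b c : ℕ, (MvPolynomial.X 0 ^ a * MvPolynomial.X 1 ^ b * MvPolynomial.X 2 ^ c :
      MvPolynomial (Fin 3) ℕ) = MvPolynomial.monomial
        (Finsupp.single 0 a + Finsupp.single 1 b + Finsupp.single 2 c) 1 := by
    intro a b c
    simp [MvPolynomial.X_pow_eq_monomial, MvPolynomial.monomial_mul]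
  have hinj : ∀ a b c a' b' c' : ℕ,
      (Finsupp.single 0 a + Finsupp.single 1 b + Finsupp.single 2 c : Fin 3 →₀ ℕ) =
        Finsupp.single 0 a' + Finsupp.single 1 b' + Finsupp.single 2 c' ↔
      (a, b, c) = (a', b', c') := by
    intro a b c a' b' c'
    constructor
    · intro h
      have h0 := DFunLike.congr_fun h 0
      have h1 := DFunLike.congr_fun h 1
      have h2 := DFunLike.congr_fun h 2
      simp at h0 h1 h2
      simp [h0, h1, h2]
    · intro h
      simp only [Prod.mk.injEq] at h
      rw [h.1, h.2.1, h.2.2]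
  -- With the three indeterminates substituted, the coefficient at the exponent `t` counts the
  -- elements with statistics `t`.
  have hc := congrArg (MvPolynomial.coeff
    (Finsupp.single 0 t.1 + Finsupp.single 1 t.2.1 + Finsupp.single 2 t.2.2))
    (H (MvPolynomial.X 0) (MvPolynomial.X 1) (MvPolynomial.X 2))
  simpa only [hmon, MvPolynomial.coeff_sum, MvPolynomial.coeff_monomial, hinj,
    ← Finset.card_filter] using hc

theorem theorem3p1 (n k : ℕ) (hk : 1 ≤ k) (hkn : k ≤ n) (σ : Equiv.Perm (Fin k)) :
    (∀ t : ℕ × ℕ × ℕ,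
      ((sigmaPartitions n k σ).filter fun π =>
        (π.mak + π.bInv, π.mak' + π.bInv, π.cinvLSB) = t).card =
      ((sigmaPartitions n k σ).filter fun π =>
        (π.mak' + π.bInv, π.mak + π.bInv, π.cinvLSB) = t).card) ∧
    (∀ maf ∈ ({OrderedPartition.mak, OrderedPartition.mak'} : Set (OrderedPartition n k → ℕ)),
      ∀ (K : Type*) [Field K] (p q : K), q ≠ 0 →
        ∑ π ∈ sigmaPartitions n k σ, p ^ (maf π + π.bInv) * q ^ π.cinvLSB =
          q ^ (k * (k - 1)) * (p / q) ^ permInv σ * pqStirling p q n k) := by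
  constructor
  · intro t
    -- The third statistic is shifted by the constant `permInv σ` to match `sum_sigmaPartitions`;
    -- the shift cancels at the end.
    have h := card_filter_eq_of_sum_pow_eq (sigmaPartitions n k σ)
      (fun π => π.mak + π.bInv) (fun π => π.mak' + π.bInv) (fun π => π.cinvLSB + permInv σ)
      (fun x y z => by
        rw [OrderedPartition.sum_sigmaPartitions, bivariatePathSum_comm, mul_comm x y,
          ← OrderedPartition.sum_sigmaPartitions]
        exact Finset.sum_congr rfl fun π _ => by ring) (t.1, t.2.1, t.2.2 + permInv σ)
    simpa only [Prod.mk.injEq, Nat.add_right_cancel_iff, Prod.ext_iff] using h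
  · intro maf hmaf K _ p q hq
    have hmak := OrderedPartition.sum_sigmaPartitions (n := n) p 1 q σ
    have hmak' := OrderedPartition.sum_sigmaPartitions (n := n) 1 p q σ
    -- The symmetry brings the `MAK'` case to the form evaluated by `bivariatePathSum_one_right`.
    rw [bivariatePathSum_comm] at hmak'
    simp only [mul_one, one_mul, one_pow, bivariatePathSum_one_right, pow_add q, ← mul_assoc,
      ← Finset.sum_mul] at hmak hmak'
    have hq' : q ^ permInv σ ≠ 0 := pow_ne_zero _ hq
    rcases hmaf with rfl | rfl
    · rw [div_pow, mul_div_assoc', div_mul_eq_mul_div, eq_div_iff hq', hmak]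
    · rw [div_pow, mul_div_assoc', div_mul_eq_mul_div, eq_div_iff hq', hmak']
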